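/- A group $G$ is called hyperbolic (in the sense of Gromov) if it has a finite generating set $S$ such that the Cayley graph of $G$ with respect to $S$ is a hyperbolic metric space; that is, if $d$ denotes the word metric on $G$ with respect to $S$ and $(x|y)_w = \tfrac12\big(d(x,w)+d(y,w)-d(x,y)\big)$, then there is a constant $\delta$ such that $$(x|y)_w \ \ge\ \min\{(x|z)_w,\,(z|y)_w\}-\delta \qquad \text{for all } w,x,y,z\in G .$$ Corollary. Let $G$ and $H$ be hyperbolic groups. Then their free product $G \ast H$ is hyperbolic. -/

import Mathlib

/-- The Gromov product `(x | y)_w = (d(x,w) + d(y,w) - d(x,y)) / 2` of two vertices `x`, `y` of a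
connected graph with respect to a base vertex `w`, where `d` is the graph metric (the length of a
shortest path). -/
noncomputable def gromovProduct {V : Type*} (Γ : SimpleGraph V) (w x y : V) : ℝ :=
  ((Γ.dist x w : ℝ) + (Γ.dist y w : ℝ) - (Γ.dist x y : ℝ)) / 2

/-- A graph is (Gromov) hyperbolic if it is connected and there is a constant `δ` such that its
vertices, with the graph metric, satisfy
`(x | y)_w ≥ min {(x | z)_w, (z | y)_w} - δ` for all `x`, `y`, `z`, `w`. -/
def IsHyperbolicGraph {V : Type*} (Γ : SimpleGraph V) : Prop :=
  Γ.Connected ∧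
    ∃ δ : ℝ, ∀ w x y z : V,
      min (gromovProduct Γ w x z) (gromovProduct Γ w z y) - δ ≤ gromovProduct Γ w x y

/-- A group is hyperbolic if it has a finite generating set `S` for which its (right, undirected)
Cayley graph, with edges joining `g` and `g * s` for `s ∈ S`, is hyperbolic. -/
def IsHyperbolicGroup (G : Type*) [Group G] : Prop :=
  ∃ S : Finset G, Subgroup.closure (S : Set G) = ⊤ ∧
    IsHyperbolicGraph (SimpleGraph.mulCayley (S : Set G))

/-! Generate the free product by the union of the generating sets of the factors. The word length of
a reduced word is then the sum of the lengths of its syllables in their factors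
(`dist_syllableProd`). Hence the Gromov product at `1` of two normal forms is the length of their
common prefix plus, if the first differing syllables lie in the same factor, the Gromov product of
these syllables there (`gromovProduct_syllableProd`).

For this expression, `splitProduct_four_point` strips the prefix common to three words. Where they
separate, the inequality holds without error, as in a tree, unless three distinct syllables of one
factor meet; then the inequality of that factor is used, once. So errors do not accumulate along
words, and one bound for the constants of the finitely many factors suffices. -/

open SimpleGraph Monoid

/-! ### Graph metrics and Gromov products. -/

section Graph

variable {V W : Type*} {Γ : SimpleGraph V} {Γ' : SimpleGraph W}

/-- A function on the vertices which increases by at most one along edges is bounded along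
geodesics. -/
lemma le_add_dist_of_adj (hΓ : Γ.Connected) (f : V → ℕ)
    (hf : ∀ u v, Γ.Adj u v → f v ≤ f u + 1) (u v : V) : f v ≤ f u + Γ.dist u v := by
  obtain ⟨p, hp⟩ := hΓ.exists_walk_length_eq_dist u v
  rw [← hp]
  clear hp
  induction p with
  | nil => simp
  | cons h p ih =>
    have := hf _ _ h
    rw [Walk.length_cons]
    omega

lemma dist_map_le_dist (hΓ : Γ.Connected) (hΓ' : Γ'.Connected) (f : V → W)
    (hf : ∀ u v, Γ.Adj u v → Γ'.dist (f u) (f v) ≤ 1) (u v : V) :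
    Γ'.dist (f u) (f v) ≤ Γ.dist u v := by
  have := le_add_dist_of_adj hΓ (fun x => Γ'.dist (f u) (f x))
    (fun x y hxy => (hΓ'.dist_triangle (v := f x)).trans (Nat.add_le_add_left (hf x y hxy) _)) u v
  simpa using this

lemma gromovProduct_nonneg (hΓ : Γ.Connected) (w x y : V) : 0 ≤ gromovProduct Γ w x y := by
  have h : Γ.dist x y ≤ Γ.dist x w + Γ.dist w y := hΓ.dist_triangle
  rw [Γ.dist_comm (u := w)] at h
  have h' : (Γ.dist x y : ℝ) ≤ Γ.dist x w + Γ.dist y w := by exact_mod_cast h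
  unfold gromovProduct
  linarith

/-- Needed when two words share a syllable and the third differs from it in the same factor: the
Gromov product there cannot exceed the length of the shared syllable. -/
lemma gromovProduct_le_dist (hΓ : Γ.Connected) (w x y : V) :
    gromovProduct Γ w x y ≤ Γ.dist w x := by
  have h : Γ.dist y w ≤ Γ.dist y x + Γ.dist x w := hΓ.dist_triangle
  rw [Γ.dist_comm (u := y) (v := x)] at h
  have h' : (Γ.dist y w : ℝ) ≤ Γ.dist x y + Γ.dist x w := by exact_mod_cast h
  rw [gromovProduct, Γ.dist_comm (u := w)]
  linarith

end Graph

/-! ### Word metrics on Cayley graphs. -/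

section Cayley

variable {K : Type*} [Group K] {S : Set K}

lemma mulCayley_connected (hS : Subgroup.closure S = ⊤) : (mulCayley S).Connected := by
  have key : ∀ g u v : K, (mulCayley S).Reachable u v → (mulCayley S).Reachable (g * u) (g * v) :=
    fun g u v h => h.map (⟨fun x => g * x, fun h => mulCayley_adj_mul_iff_right.2 h⟩ :
      mulCayley S →g mulCayley S)
  have h1 : ∀ g : K, (mulCayley S).Reachable 1 g := by
    intro g
    have hg : g ∈ Subgroup.closure S := by simp [hS]
    induction hg using Subgroup.closure_induction with
    | mem s hs =>
      by_cases h : s = 1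
      · rw [h]
      · exact Adj.reachable ((mulCayley_adj _ _ _).2 ⟨Ne.symm h, by simp [hs]⟩)
    | one => exact Reachable.refl _
    | mul x y _ _ hx hy => exact hx.trans (by simpa using key x _ _ hy)
    | inv x _ hx => exact (by simpa using key x⁻¹ _ _ hx : (mulCayley S).Reachable x⁻¹ 1).symm
  exact (connected_iff _).2 ⟨fun u v => (h1 u).symm.trans (h1 v), ⟨1⟩⟩

lemma mulCayley_dist_mul_left (hS : Subgroup.closure S = ⊤) (g u v : K) :
    (mulCayley S).dist (g * u) (g * v) = (mulCayley S).dist u v := by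
  have hc := mulCayley_connected hS
  have key : ∀ g u v : K, (mulCayley S).dist (g * u) (g * v) ≤ (mulCayley S).dist u v :=
    fun g u v => dist_map_le_dist hc hc (fun x => g * x)
      (fun a b h => (dist_eq_one_iff_adj.2 (mulCayley_adj_mul_iff_right.2 h)).le) u v
  refine le_antisymm (key g u v) ?_
  simpa using key g⁻¹ (g * u) (g * v)

lemma mulCayley_dist_eq (hS : Subgroup.closure S = ⊤) (u v : K) :
    (mulCayley S).dist u v = (mulCayley S).dist 1 (u⁻¹ * v) := by
  rw [← mulCayley_dist_mul_left hS u⁻¹ u v, inv_mul_cancel]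

lemma mulCayley_gromovProduct_mul_left (hS : Subgroup.closure S = ⊤) (g w x y : K) :
    gromovProduct (mulCayley S) (g * w) (g * x) (g * y) = gromovProduct (mulCayley S) w x y := by
  simp only [gromovProduct, mulCayley_dist_mul_left hS]

lemma mulCayley_dist_one_inv (hS : Subgroup.closure S = ⊤) (g : K) :
    (mulCayley S).dist 1 g⁻¹ = (mulCayley S).dist 1 g := by
  rw [← mulCayley_dist_mul_left hS g, dist_comm]
  simp

lemma mulCayley_dist_one_mul_le (hS : Subgroup.closure S = ⊤) (g h : K) :
    (mulCayley S).dist 1 (g * h) ≤ (mulCayley S).dist 1 g + (mulCayley S).dist 1 h := by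
  refine ((mulCayley_connected hS).dist_triangle (v := g)).trans (Nat.add_le_add_left ?_ _)
  rw [mulCayley_dist_eq hS, inv_mul_cancel_left]

lemma mulCayley_dist_one_le_one {s : K} (hs : s ∈ S) : (mulCayley S).dist 1 s ≤ 1 := by
  by_cases h : s = 1
  · simp [h]
  · exact (dist_eq_one_iff_adj.2 ((mulCayley_adj _ _ _).2 ⟨Ne.symm h, by simp [hs]⟩)).le

/-- A homomorphism that maps generators to generators does not increase the word length. -/
lemma mulCayley_dist_map_le {K' : Type*} [Group K'] {S' : Set K'} (hS : Subgroup.closure S = ⊤)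
    (hS' : Subgroup.closure S' = ⊤) (f : K →* K') (hf : ∀ s ∈ S, f s ∈ S') (u v : K) :
    (mulCayley S').dist (f u) (f v) ≤ (mulCayley S).dist u v := by
  refine dist_map_le_dist (mulCayley_connected hS) (mulCayley_connected hS') f ?_ u v
  intro a b hab
  obtain ⟨-, h | h⟩ := (mulCayley_adj _ _ _).1 hab
  · rw [mulCayley_dist_eq hS', ← map_inv, ← map_mul]
    exact mulCayley_dist_one_le_one (hf _ h)
  · rw [dist_comm, mulCayley_dist_eq hS', ← map_inv, ← map_mul]
    exact mulCayley_dist_one_le_one (hf _ h)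

/-- By homogeneity, hyperbolicity of a Cayley graph may be tested at the identity. -/
lemma mulCayley_isHyperbolicGraph (hS : Subgroup.closure S = ⊤) (δ : ℝ)
    (h : ∀ x y z : K, min (gromovProduct (mulCayley S) 1 x z) (gromovProduct (mulCayley S) 1 z y) - δ
      ≤ gromovProduct (mulCayley S) 1 x y) : IsHyperbolicGraph (mulCayley S) := by
  refine ⟨mulCayley_connected hS, δ, fun w x y z => ?_⟩
  have key : ∀ a b, gromovProduct (mulCayley S) w a b =
      gromovProduct (mulCayley S) 1 (w⁻¹ * a) (w⁻¹ * b) := fun a b => by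
    rw [← mulCayley_gromovProduct_mul_left hS w⁻¹, inv_mul_cancel]
  simp only [key]
  exact h _ _ _

lemma IsHyperbolicGroup.of_mulEquiv {K' : Type*} [Group K'] (e : K ≃* K')
    (hK : IsHyperbolicGroup K) : IsHyperbolicGroup K' := by
  classical
  obtain ⟨S, hS, -, δ, hδ⟩ := hK
  have hS' : Subgroup.closure ((S.image e : Finset K') : Set K') = ⊤ := by
    have := MonoidHom.map_closure e.toMonoidHom (S : Set K)
    rw [hS, ← MonoidHom.range_eq_map, MonoidHom.range_eq_top.2 e.surjective] at this
    rw [Finset.coe_image]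
    exact this.symm
  have hd : ∀ u v, (mulCayley ((S.image e : Finset K') : Set K')).dist u v =
      (mulCayley (S : Set K)).dist (e.symm u) (e.symm v) := by
    intro u v
    refine le_antisymm ?_ ?_
    · have := mulCayley_dist_map_le hS hS' e.toMonoidHom
        (fun s hs => Finset.mem_coe.2 (Finset.mem_image_of_mem e hs)) (e.symm u) (e.symm v)
      simpa using this
    · refine mulCayley_dist_map_le hS' hS e.symm.toMonoidHom (fun s hs => ?_) u v
      obtain ⟨t, ht, rfl⟩ := Finset.mem_image.1 (Finset.mem_coe.1 hs)
      simpa using ht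
  refine ⟨S.image e, hS', mulCayley_connected hS', δ, fun w x y z => ?_⟩
  simp only [gromovProduct, hd]
  exact hδ _ _ _ _

end Cayley

/-! ### Lengths of lists of syllables. -/

section SyllableLength

variable {ι : Type*} {M : ι → Type*}

/-- The sum of the lengths of the syllables. -/
def syllableLength (L : ∀ i, M i → ℕ) (l : List (Σ i, M i)) : ℕ := (l.map fun p => L p.1 p.2).sum

@[simp] lemma syllableLength_nil (L : ∀ i, M i → ℕ) : syllableLength L [] = 0 := rfl

@[simp] lemma syllableLength_cons (L : ∀ i, M i → ℕ) (p : Σ i, M i) (l : List (Σ i, M i)) :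
    syllableLength L (p :: l) = L p.1 p.2 + syllableLength L l := rfl

@[simp] lemma syllableLength_append (L : ∀ i, M i → ℕ) (l l' : List (Σ i, M i)) :
    syllableLength L (l ++ l') = syllableLength L l + syllableLength L l' := by
  simp [syllableLength]

end SyllableLength

/-! ### The four-point condition for lists of syllables. -/

section SplitProduct

variable {ι : Type*} {M : ι → Type*}

open scoped Classical in
/-- Combines functions `P i` on the factors into a function of two lists of syllables: the length
of the longest common prefix, plus the value of `P` at the first different pair of syllables if
these belong to the same factor. -/
noncomputable def splitProduct (L : ∀ i, M i → ℕ) (P : ∀ i, M i → M i → ℝ) :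
    List (Σ i, M i) → List (Σ i, M i) → ℝ
  | [], _ => 0
  | _ :: _, [] => 0
  | p :: x, q :: y =>
    if p = q then L p.1 p.2 + splitProduct L P x y
    else if h : p.1 = q.1 then P q.1 (h ▸ p.2) q.2 else 0

variable (L : ∀ i, M i → ℕ) (P : ∀ i, M i → M i → ℝ)

@[simp] lemma splitProduct_nil_left (y : List (Σ i, M i)) : splitProduct L P [] y = 0 := by
  simp [splitProduct]

@[simp] lemma splitProduct_nil_right (x : List (Σ i, M i)) : splitProduct L P x [] = 0 := by
  cases x <;> simp [splitProduct]

lemma splitProduct_cons_self (p : Σ i, M i) (x y : List (Σ i, M i)) :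
    splitProduct L P (p :: x) (p :: y) = L p.1 p.2 + splitProduct L P x y := by
  simp [splitProduct]

lemma splitProduct_cons_of_ne {i : ι} {a b : M i} (h : a ≠ b) (x y : List (Σ i, M i)) :
    splitProduct L P (⟨i, a⟩ :: x) (⟨i, b⟩ :: y) = P i a b := by
  simp [splitProduct, h]

lemma splitProduct_cons_of_index_ne {p q : Σ i, M i} (h : p.1 ≠ q.1) (x y : List (Σ i, M i)) :
    splitProduct L P (p :: x) (q :: y) = 0 := by
  have : p ≠ q := fun e => h (by rw [e])
  simp [splitProduct, h, this]

variable {L P}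

lemma splitProduct_nonneg (hP : ∀ i a b, 0 ≤ P i a b) (x y : List (Σ i, M i)) :
    0 ≤ splitProduct L P x y := by
  induction x generalizing y with
  | nil => simp
  | cons p x ih =>
    cases y with
    | nil => simp
    | cons q y =>
      rw [splitProduct]
      split_ifs
      · exact add_nonneg (Nat.cast_nonneg _) (ih y)
      · exact hP _ _ _
      · exact le_rfl

/-- The four point condition for the factors implies that for `splitProduct`. -/
lemma splitProduct_four_point (hP : ∀ i a b, 0 ≤ P i a b) (hPl : ∀ i a b, P i a b ≤ L i a) {δ : ℝ} (hδ : 0 ≤ δ)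
    (h4 : ∀ i a b c, min (P i a c) (P i c b) - δ ≤ P i a b) (x y z : List (Σ i, M i)) :
    min (splitProduct L P x z) (splitProduct L P z y) - δ ≤ splitProduct L P x y := by
  have h0 := splitProduct_nonneg (L := L) hP
  induction x generalizing y z with
  | nil =>
    have := min_le_left (splitProduct L P [] z) (splitProduct L P z y)
    simp only [splitProduct_nil_left] at this ⊢
    linarith
  | cons p x ih =>
    rcases z with _ | ⟨r, z⟩
    · have := h0 (p :: x) y
      simp only [splitProduct_nil_left, splitProduct_nil_right, min_self]
      linarith
    rcases y with _ | ⟨q, y⟩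
    · have := min_le_right (splitProduct L P (p :: x) (r :: z)) (splitProduct L P (r :: z) [])
      simp only [splitProduct_nil_right] at this ⊢
      linarith
    have hxy := h0 (p :: x) (q :: y)
    -- If the head of `z` lies in another factor than that of `x` or `y`, one term of the minimum is
    -- zero.
    by_cases hpr : p.1 ≠ r.1
    · rw [splitProduct_cons_of_index_ne L P hpr]
      linarith [min_le_left 0 (splitProduct L P (r :: z) (q :: y))]
    by_cases hrq : r.1 ≠ q.1
    · rw [splitProduct_cons_of_index_ne L P hrq]
      linarith [min_le_right (splitProduct L P (p :: x) (r :: z)) 0]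
    obtain ⟨i, a⟩ := p
    obtain ⟨j, c⟩ := r
    obtain ⟨k, b⟩ := q
    simp only [ne_eq, not_not] at hpr hrq
    subst hpr hrq
    have hz := h0 z y
    have hm := min_le_left (splitProduct L P (⟨i, a⟩ :: x) (⟨i, c⟩ :: z))
      (splitProduct L P (⟨i, c⟩ :: z) (⟨i, b⟩ :: y))
    have hm' := min_le_right (splitProduct L P (⟨i, a⟩ :: x) (⟨i, c⟩ :: z))
      (splitProduct L P (⟨i, c⟩ :: z) (⟨i, b⟩ :: y))
    by_cases hac : a = c
    · subst hac
      by_cases hab : a = b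
      · subst hab
        simp only [splitProduct_cons_self, min_add_add_left]
        linarith [ih y z]
      · simp only [splitProduct_cons_of_ne L P hab] at hm' ⊢
        linarith
    · by_cases hcb : c = b
      · subst hcb
        simp only [splitProduct_cons_of_ne L P hac] at hm ⊢
        linarith
      -- If only `z` departs, the minimum is at most `P i a c ≤ L i a`, which the common syllable of
      -- `x` and `y` already contributes.
      · by_cases hab : a = b
        · subst hab
          simp only [splitProduct_cons_of_ne L P hac, splitProduct_cons_self] at hm ⊢
          linarith [hPl i a c, h0 x y]
        · simp only [splitProduct_cons_of_ne L P hac, splitProduct_cons_of_ne L P hcb,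
            splitProduct_cons_of_ne L P hab]
          exact h4 i a b c

end SplitProduct

/-! ### Reduced words in the free product. -/

section FreeProduct

variable {ι : Type*} {M : ι → Type*} [∀ i, Group (M i)]

/-- The product of a list of syllables in the free product. -/
def syllableProd (l : List (Σ i, M i)) : CoprodI M := (l.map fun p => CoprodI.of p.2).prod

/-- A list of syllables is reduced if its syllables are nontrivial and adjacent ones come from
different factors. -/
def IsReducedList (l : List (Σ i, M i)) : Prop :=
  (∀ p ∈ l, p.2 ≠ 1) ∧ l.IsChain fun p q => p.1 ≠ q.1

/-- The list of inverse syllables in the opposite order. -/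
def syllableInv (l : List (Σ i, M i)) : List (Σ i, M i) :=
  (l.map fun p => (⟨p.1, p.2⁻¹⟩ : Σ i, M i)).reverse

@[simp] lemma syllableProd_nil : syllableProd ([] : List (Σ i, M i)) = 1 := rfl

@[simp] lemma syllableProd_cons (p : Σ i, M i) (l : List (Σ i, M i)) :
    syllableProd (p :: l) = CoprodI.of p.2 * syllableProd l := rfl

@[simp] lemma syllableProd_append (l l' : List (Σ i, M i)) :
    syllableProd (l ++ l') = syllableProd l * syllableProd l' := by
  simp [syllableProd]

@[simp] lemma syllableInv_cons (p : Σ i, M i) (l : List (Σ i, M i)) :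
    syllableInv (p :: l) = syllableInv l ++ [⟨p.1, p.2⁻¹⟩] := by
  simp [syllableInv]

@[simp] lemma syllableProd_inv (l : List (Σ i, M i)) :
    syllableProd (syllableInv l) = (syllableProd l)⁻¹ := by
  induction l with
  | nil => simp [syllableInv]
  | cons p l ih => simp [ih]

lemma syllableLength_inv {L : ∀ i, M i → ℕ} (hL : ∀ i m, L i m⁻¹ = L i m) (l : List (Σ i, M i)) :
    syllableLength L (syllableInv l) = syllableLength L l := by
  induction l with
  | nil => simp [syllableInv]
  | cons p l ih => simp [ih, hL, add_comm]

lemma IsReducedList.tail {p : Σ i, M i} {l : List (Σ i, M i)} (h : IsReducedList (p :: l)) :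
    IsReducedList l :=
  ⟨fun q hq => h.1 q (List.mem_cons_of_mem _ hq), h.2.tail⟩

lemma IsReducedList.inv {l : List (Σ i, M i)} (h : IsReducedList l) :
    IsReducedList (syllableInv l) := by
  refine ⟨fun p hp => ?_, ?_⟩
  · simp only [syllableInv, List.mem_reverse, List.mem_map] at hp
    obtain ⟨q, hq, rfl⟩ := hp
    simpa using h.1 q hq
  · rw [syllableInv, List.isChain_reverse, List.isChain_map]
    exact h.2.imp fun _ _ => Ne.symm

lemma IsReducedList.inv_append {i j : ι} {a : M i} {b : M j} {x y : List (Σ i, M i)}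
    (hx : IsReducedList (⟨i, a⟩ :: x)) (hy : IsReducedList (⟨j, b⟩ :: y)) (hij : i ≠ j) :
    IsReducedList (syllableInv (⟨i, a⟩ :: x) ++ ⟨j, b⟩ :: y) := by
  refine ⟨fun p hp => (List.mem_append.1 hp).elim (hx.inv.1 p) (hy.1 p), ?_⟩
  refine List.IsChain.append hx.inv.2 hy.2 ?_
  simp [hij]

lemma IsReducedList.replace_head {i : ι} {a c : M i} {x : List (Σ i, M i)}
    (hx : IsReducedList (⟨i, a⟩ :: x)) (hc : c ≠ 1) : IsReducedList (⟨i, c⟩ :: x) := by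
  refine ⟨?_, ?_⟩
  · simp only [List.mem_cons, forall_eq_or_imp]
    exact ⟨hc, hx.tail.1⟩
  · have := hx.2
    rw [List.isChain_cons] at this ⊢
    exact this

/-- The syllables `a⁻¹` and `b` merge into a single one, nontrivial since `a ≠ b`, so no further
cancellation occurs. This is the normal form of the quotient of two words separating inside one
factor. -/
lemma IsReducedList.inv_append_mul {i : ι} {a b : M i} {x y : List (Σ i, M i)}
    (hx : IsReducedList (⟨i, a⟩ :: x)) (hy : IsReducedList (⟨i, b⟩ :: y)) (hab : a ≠ b) :
    IsReducedList (syllableInv x ++ ⟨i, a⁻¹ * b⟩ :: y) := by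
  have hy' : IsReducedList (⟨i, a⁻¹ * b⟩ :: y) :=
    hy.replace_head (by rwa [Ne, inv_mul_eq_one])
  refine ⟨fun p hp => (List.mem_append.1 hp).elim (hx.tail.inv.1 p) (hy'.1 p), ?_⟩
  refine List.IsChain.append hx.tail.inv.2 hy'.2 ?_
  have := hx.inv.2
  rw [syllableInv_cons, List.isChain_append] at this
  simpa using this.2.2

/-! ### Word length and Gromov products in the free product. -/

/-- The union of generating sets of the factors, in the free product. -/
def coprodGenerators (S : ∀ i, Set (M i)) : Set (CoprodI M) := ⋃ i, CoprodI.of '' S i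

lemma closure_coprodGenerators {S : ∀ i, Set (M i)} (hS : ∀ i, Subgroup.closure (S i) = ⊤) :
    Subgroup.closure (coprodGenerators S) = ⊤ := by
  refine (Subgroup.eq_top_iff' _).2 fun g => ?_
  induction g using CoprodI.induction_on with
  | one => exact one_mem _
  | of i m =>
    have h : (Subgroup.closure (S i)).map CoprodI.of ≤ Subgroup.closure (coprodGenerators S) := by
      rw [MonoidHom.map_closure]
      exact Subgroup.closure_mono (Set.subset_iUnion_of_subset i subset_rfl)
    exact h ⟨m, by simp [hS i], rfl⟩
  | mul x y hx hy => exact mul_mem hx hy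

-- Left multiplication by an element of a factor changes only the leading syllable in that factor,
-- which is taken to be `1` if absent.
open scoped Classical in
lemma syllableLength_of_smul_le {L : ∀ i, M i → ℕ} (h1 : ∀ i, L i 1 = 0)
    (hmul : ∀ i a b, L i (a * b) ≤ L i a + L i b) {i : ι} (m : M i) (w : CoprodI.Word M) :
    syllableLength L (CoprodI.of m • w).toList ≤ L i m + syllableLength L w.toList := by
  have hr : ∀ p : CoprodI.Word.Pair M i, syllableLength L (CoprodI.Word.rcons p).toList =
      L i p.head + syllableLength L p.tail.toList := by
    intro p
    unfold CoprodI.Word.rcons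
    split_ifs with h
    · simp [h, h1]
    · simp
  have hw := hr (CoprodI.Word.equivPair i w)
  rw [← CoprodI.Word.equivPair_symm, Equiv.symm_apply_apply] at hw
  rw [CoprodI.Word.of_smul_def, hr, hw]
  have := hmul i m (CoprodI.Word.equivPair i w).head
  simp only
  omega

open scoped Classical in
/-- The sum of syllable lengths of the normal form of an element of a free product is bounded by
its word length. -/
lemma syllableLength_le_dist {S : ∀ i, Set (M i)} (hS : ∀ i, Subgroup.closure (S i) = ⊤)
    (g : CoprodI M) :
    syllableLength (fun i m => (mulCayley (S i)).dist 1 m) (CoprodI.Word.equiv g).toList ≤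
      (mulCayley (coprodGenerators S)).dist 1 g := by
  have hS' := closure_coprodGenerators hS
  set L : ∀ i, M i → ℕ := fun i m => (mulCayley (S i)).dist 1 m with hL
  have hstep : ∀ (i : ι) (m : M i) (h : CoprodI M), L i m ≤ 1 →
      syllableLength L (CoprodI.Word.equiv (CoprodI.of m * h)).toList ≤
        syllableLength L (CoprodI.Word.equiv h).toList + 1 := by
    intro i m h hm
    have := syllableLength_of_smul_le (L := L) (fun i => dist_self)
      (fun i => mulCayley_dist_one_mul_le (hS i)) m (CoprodI.Word.equiv h)
    have he : CoprodI.Word.equiv (CoprodI.of m * h) = CoprodI.of m • CoprodI.Word.equiv h :=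
      mul_smul (CoprodI.of m) h (CoprodI.Word.empty : CoprodI.Word M)
    rw [he]
    omega
  -- Edges are right multiplications, while `hstep` controls left ones; hence the inverses and the
  -- endpoint `g⁻¹`.
  have := le_add_dist_of_adj (mulCayley_connected hS')
    (fun h => syllableLength L (CoprodI.Word.equiv h⁻¹).toList) (fun u v huv => by
      obtain ⟨-, h | h⟩ := (mulCayley_adj _ _ _).1 huv
      · obtain ⟨i, s, hs, he⟩ := Set.mem_iUnion.1 h
        have hv : v⁻¹ = CoprodI.of s⁻¹ * u⁻¹ := by rw [map_inv, he]; group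
        simp only [hv]
        refine hstep i _ _ ?_
        rw [hL]
        simp only [mulCayley_dist_one_inv (hS i)]
        exact mulCayley_dist_one_le_one hs
      · obtain ⟨i, s, hs, he⟩ := Set.mem_iUnion.1 h
        have hv : v⁻¹ = CoprodI.of s * u⁻¹ := by rw [he]; group
        simp only [hv]
        exact hstep i _ _ (mulCayley_dist_one_le_one hs)) 1 g⁻¹
  rw [mulCayley_dist_one_inv hS'] at this
  simpa [CoprodI.Word.equiv] using this

/-- The word length in a free product is additive on reduced lists of syllables. -/
lemma dist_syllableProd {S : ∀ i, Set (M i)} (hS : ∀ i, Subgroup.closure (S i) = ⊤)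
    {l : List (Σ i, M i)} (hl : IsReducedList l) :
    (mulCayley (coprodGenerators S)).dist 1 (syllableProd l) =
      syllableLength (fun i m => (mulCayley (S i)).dist 1 m) l := by
  classical
  have hS' := closure_coprodGenerators hS
  refine le_antisymm ?_ ?_
  -- Subadditivity gives the upper bound for arbitrary lists; only the lower bound needs `l` to be a
  -- normal form.
  · clear hl
    induction l with
    | nil => simp
    | cons p l ih =>
      refine (mulCayley_dist_one_mul_le hS' _ _).trans (add_le_add ?_ ih)
      have := mulCayley_dist_map_le (hS p.1) hS' CoprodI.of
        (fun s hs => Set.mem_iUnion.2 ⟨p.1, s, hs, rfl⟩) 1 p.2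
      simpa using this
  · have := syllableLength_le_dist hS (syllableProd l)
    have hw : CoprodI.Word.equiv (syllableProd l) = ⟨l, hl.1, hl.2⟩ :=
      CoprodI.Word.equiv.apply_symm_apply ⟨l, hl.1, hl.2⟩
    rwa [hw] at this

/-- The Gromov product at the identity in a free product, in terms of normal forms. -/
lemma gromovProduct_syllableProd {S : ∀ i, Set (M i)} (hS : ∀ i, Subgroup.closure (S i) = ⊤)
    {x y : List (Σ i, M i)} (hx : IsReducedList x) (hy : IsReducedList y) :
    gromovProduct (mulCayley (coprodGenerators S)) 1 (syllableProd x) (syllableProd y) =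
      splitProduct (fun i m => (mulCayley (S i)).dist 1 m)
        (fun i => gromovProduct (mulCayley (S i)) 1) x y := by
  have hS' := closure_coprodGenerators hS
  set L : ∀ i, M i → ℕ := fun i m => (mulCayley (S i)).dist 1 m with hL
  have hLinv : ∀ i m, L i m⁻¹ = L i m := fun i => mulCayley_dist_one_inv (hS i)
  have key : ∀ {u v l : List (Σ i, M i)}, IsReducedList u → IsReducedList v → IsReducedList l →
      syllableProd l = (syllableProd u)⁻¹ * syllableProd v →
      gromovProduct (mulCayley (coprodGenerators S)) 1 (syllableProd u) (syllableProd v) =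
        ((syllableLength L u : ℝ) + syllableLength L v - syllableLength L l) / 2 := by
    intro u v l hu hv hl h
    rw [gromovProduct, mulCayley_dist_eq hS' (syllableProd u) (syllableProd v), ← h,
      dist_comm, dist_syllableProd hS hu, dist_comm, dist_syllableProd hS hv,
      dist_syllableProd hS hl]
  induction x generalizing y with
  | nil => simp [gromovProduct, dist_comm]
  | cons p x ih =>
    rcases y with _ | ⟨q, y⟩
    · simp [gromovProduct]
    obtain ⟨i, a⟩ := p
    obtain ⟨j, b⟩ := q
    by_cases hij : i = j
    · subst hij
      by_cases hab : a = b
      · subst hab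
        rw [splitProduct_cons_self, ← ih hx.tail hy.tail, gromovProduct, gromovProduct,
          syllableProd_cons, syllableProd_cons, mulCayley_dist_mul_left hS', ← syllableProd_cons,
          ← syllableProd_cons]
        simp only [dist_comm (v := (1 : CoprodI M))]
        rw [dist_syllableProd hS hx, dist_syllableProd hS hy, dist_syllableProd hS hx.tail,
          dist_syllableProd hS hy.tail]
        simp only [syllableLength_cons, hL]
        push_cast
        ring
      -- The lengths of the tails cancel, leaving `(|a| + |b| - |a⁻¹ * b|) / 2`, the Gromov product
      -- in the factor.
      · rw [splitProduct_cons_of_ne _ _ hab,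
          key hx hy (hx.inv_append_mul hy hab) (by simp [mul_assoc]), gromovProduct,
          mulCayley_dist_eq (hS i) a b, dist_comm (u := a), dist_comm (u := b)]
        simp only [syllableLength_append, syllableLength_cons, syllableLength_inv hLinv]
        push_cast
        ring
    · rw [splitProduct_cons_of_index_ne _ _ hij, key hx hy (hx.inv_append hy hij)
        (by rw [syllableProd_append, syllableProd_inv])]
      simp only [syllableLength_append, syllableLength_inv hLinv]
      push_cast
      ring

open scoped Classical in
lemma exists_isReducedList (g : CoprodI M) : ∃ l, IsReducedList l ∧ syllableProd l = g :=
  ⟨(CoprodI.Word.equiv g).toList, ⟨(CoprodI.Word.equiv g).ne_one, (CoprodI.Word.equiv g).chain_ne⟩,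
    CoprodI.Word.equiv.symm_apply_apply g⟩

/-- The free product of a finite family of hyperbolic groups is hyperbolic. -/
theorem IsHyperbolicGroup.coprodI [Fintype ι] (h : ∀ i, IsHyperbolicGroup (M i)) :
    IsHyperbolicGroup (CoprodI M) := by
  classical
  choose S hS hc δ hδ using h
  have hgen : ((Finset.univ.biUnion fun i => (S i).image CoprodI.of : Finset (CoprodI M)) :
      Set (CoprodI M)) = coprodGenerators fun i => (S i : Set (M i)) := by
    simp [coprodGenerators]
  refine ⟨Finset.univ.biUnion fun i => (S i).image CoprodI.of, ?_, ?_⟩ <;> rw [hgen]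
  · exact closure_coprodGenerators hS
  -- The sum of absolute values serves as a nonnegative upper bound for every `δ i`.
  refine mulCayley_isHyperbolicGraph (closure_coprodGenerators hS) (∑ i, |δ i|) fun x y z => ?_
  obtain ⟨x, hx, rfl⟩ := exists_isReducedList x
  obtain ⟨y, hy, rfl⟩ := exists_isReducedList y
  obtain ⟨z, hz, rfl⟩ := exists_isReducedList z
  rw [gromovProduct_syllableProd hS hx hz, gromovProduct_syllableProd hS hz hy,
    gromovProduct_syllableProd hS hx hy]
  refine splitProduct_four_point (fun i => gromovProduct_nonneg (hc i) 1)
    (fun i => gromovProduct_le_dist (hc i) 1)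
    (Finset.sum_nonneg fun i _ => abs_nonneg (δ i)) (fun i a b c => ?_) x y z
  have h1 := hδ i 1 a b c
  have h2 : |δ i| ≤ ∑ i, |δ i| :=
    Finset.single_le_sum (f := fun i => |δ i|) (fun i _ => abs_nonneg (δ i)) (Finset.mem_univ i)
  linarith [le_abs_self (δ i)]

end FreeProduct

/-! ### From families to two groups. -/

section Coprod

universe u v

/-- Two groups as a family in a common universe. -/
def GroupPair (G : Type u) (H : Type v) : Bool → Type (max u v)
  | false => ULift.{v} G
  | true => ULift.{u} H

instance (G : Type u) (H : Type v) [Group G] [Group H] : ∀ b, Group (GroupPair G H b)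
  | false => inferInstanceAs (Group (ULift.{v} G))
  | true => inferInstanceAs (Group (ULift.{u} H))

variable (G : Type u) (H : Type v) [Group G] [Group H]

/-- The embedding of the first group. -/
def groupPairInl : G ≃* GroupPair G H false := MulEquiv.ulift.symm

/-- The embedding of the second group. -/
def groupPairInr : H ≃* GroupPair G H true := MulEquiv.ulift.symm

/-- The binary free product as the free product of a family. -/
def coprodIGroupPairEquiv : CoprodI (GroupPair G H) ≃* Coprod G H :=
  MonoidHom.toMulEquiv
    (CoprodI.lift fun
      | false => Coprod.inl.comp (groupPairInl G H).symm.toMonoidHom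
      | true => Coprod.inr.comp (groupPairInr G H).symm.toMonoidHom)
    (Coprod.lift (CoprodI.of.comp (groupPairInl G H).toMonoidHom)
      (CoprodI.of.comp (groupPairInr G H).toMonoidHom))
    (CoprodI.ext_hom _ _ fun
      | false => by ext; simp
      | true => by ext; simp)
    (by ext <;> simp)

end Coprod

theorem mainTheorem8 {G H : Type*} [Group G] [Group H]
    (hG : IsHyperbolicGroup G) (hH : IsHyperbolicGroup H) :
    IsHyperbolicGroup (Monoid.Coprod G H) :=
  (IsHyperbolicGroup.coprodI fun
    | false => hG.of_mulEquiv (groupPairInl G H)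
    | true => hH.of_mulEquiv (groupPairInr G H)).of_mulEquiv (coprodIGroupPairEquiv G H)
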